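/- Let $\mathcal C\subseteq\mathbb F_2^n$ be a binary linear code, let $X=(X_1,\dots,X_n)$ be uniformly distributed on $\mathcal C$, and for $0\le\epsilon\le 1$ let $Y^\epsilon$ be the result of passing $X$ through the memoryless binary erasure channel with erasure probability $\epsilon$. Write $Y^\epsilon_{\sim i}$ for $(Y^\epsilon_k)_{k\ne i}$ and define the EXIT function, with entropies in bits, by $$g(\epsilon)=\frac1n\sum_{i=1}^n H(X_i\mid Y^\epsilon_{\sim i}).$$ For $i\neq j$ and $z\in\{0,1\}^n$, and for $s,t\in\{0,1\}$, let $\mathcal C^{ij}_{st}(z)$ be the set of codewords $c\in\mathcal C$ with $(c_i,c_j)=(s,t)$ whose support is contained in the support of $z$. Let \begin{align*} \mathcal B^{ij}_2&=\{z:\ \mathcal C^{ij}_{01}(z)\ne\emptyset,\ \mathcal C^{ij}_{10}(z)=\mathcal C^{ij}_{11}(z)=\emptyset\},\\ \mathcal B^{ij}_3&=\{z:\ \mathcal C^{ij}_{10}(z)\ne\emptyset,\ \mathcal C^{ij}_{01}(z)=\mathcal C^{ij}_{11}(z)=\emptyset\},\\ \mathcal B^{ij}_4&=\{z:\ \mathcal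 C^{ij}_{11}(z)\ne\emptyset,\ \mathcal C^{ij}_{01}(z)=\mathcal C^{ij}_{10}(z)=\emptyset\}, \end{align*} let $Z^\epsilon\in\{0,1\}^n$ be the random vector with $Z^\epsilon_i=Z^\epsilon_j=1$ and with the remaining coordinates independent Bernoulli($\epsilon$), and set $$\alpha^\epsilon_{ij}=\Pr\bigl(Z^\epsilon\in\mathcal B^{ij}_4\ \big|\ Z^\epsilon\in\mathcal B^{ij}_2\cup\mathcal B^{ij}_3\cup\mathcal B^{ij}_4\bigr)$$ (with the value $0$ if the conditioning event has probability $0$). There is a function $c$ of $\delta\in(0,\tfrac12]$ alone, bounded below by a positive constant on $[\delta_0,\tfrac12]$ for every $\delta_0>0$, such that the following holds for all $0<\delta\le\frac12$, all $n$, all $\epsilon\in[0,1]$ and all $1$-transitive binary linear codes $\mathcal C$ of length $n$ (that is, for all coordinates $i,j$ some permutation of the coordinates that leaves $\mathcal C$ invariant maps $i$ to $j$): if $g(\epsilon)\in(\delta,1-\delta)$, then $g$, as a function on $[0,1]$, is differentiable at $\epsilon$ and $$g'(\epsilon)\ \ge\ \frac{c(\delta)}{n^{3/2}}\sum_{i=1}^n\sum_{j\ne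 i}\alpha^\epsilon_{ij}.$$ -/

import Mathlib

noncomputable section

namespace ExitBEC

open scoped BigOperators
open Classical in
/-- The probability that the random variable `f`, defined on a finite sample space with
probability mass function `p`, takes the value `a`. -/
def lawOf {Ω α : Type*} [Fintype Ω] (p : Ω → ℝ) (f : Ω → α) (a : α) : ℝ :=
  ∑ ω, if f ω = a then p ω else 0

/-- The conditional Shannon entropy `H(U | V)`, in bits, of random variables `U`, `V` on a finite
sample space with probability mass function `p`:
`H(U | V) = - ∑ u, v, P(U = u, V = v) log₂ P(U = u | V = v)`.
Terms with `P(U = u, V = v) = 0` contribute `0`. -/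
def condEntropy {Ω α β : Type*} [Fintype Ω] [Fintype α] [Fintype β]
    (p : Ω → ℝ) (U : Ω → α) (V : Ω → β) : ℝ :=
  -∑ u : α, ∑ v : β, lawOf p (fun ω => (U ω, V ω)) (u, v) *
      Real.logb 2 (lawOf p (fun ω => (U ω, V ω)) (u, v) / lawOf p V v)

/-- Binary words of length `n`. -/
abbrev Word (n : ℕ) : Type := Fin n → ZMod 2

/-- Channel outputs of length `n`; `none` is the erasure symbol `?`. -/
abbrev Output (n : ℕ) : Type := Fin n → Option (ZMod 2)

/-- Binary linear codes of length `n`. -/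
abbrev LinearCode (n : ℕ) : Type := Submodule (ZMod 2) (Word n)

/-- The code `C` is `1`-transitive: for all coordinates `i`, `j` there is a permutation of the
coordinates that maps `i` to `j` and leaves `C` invariant. -/
def OneTransitive {n : ℕ} (C : LinearCode n) : Prop :=
  ∀ i j : Fin n, ∃ π : Equiv.Perm (Fin n), π i = j ∧ ∀ x : Word n, x ∘ π ∈ C ↔ x ∈ C

/-- The transition probability `W(y | x)` of the binary erasure channel with erasure
probability `ε`. -/
def becKernel (ε : ℝ) (x : ZMod 2) : Option (ZMod 2) → ℝ
  | none => ε
  | some b => if b = x then 1 - ε else 0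

open Classical in
/-- The joint probability mass function of `(X, Y^ε)`: `X` is uniform on the code `C`, and `Y^ε` is
the result of passing `X` through `n` independent uses of the BEC with parameter `ε`. -/
def jointPMF {n : ℕ} (C : LinearCode n) (ε : ℝ) (ω : Word n × Output n) : ℝ :=
  (if ω.1 ∈ C then (Nat.card C : ℝ)⁻¹ else 0) * ∏ k, becKernel ε (ω.1 k) (ω.2 k)

/-- `H(X_i | Y^ε_{∼i})`, where `Y^ε_{∼i}` collects all the outputs except the `i`-th. -/
def bitEntropy {n : ℕ} (C : LinearCode n) (ε : ℝ) (i : Fin n) : ℝ :=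
  condEntropy (jointPMF C ε) (fun ω => ω.1 i) (fun ω => fun k : {k : Fin n // k ≠ i} => ω.2 k)

/-- The EXIT function `g(ε) = (1/n) ∑ i, H(X_i | Y^ε_{∼i})` (of interest for `ε ∈ [0, 1]`). -/
def exitFunction {n : ℕ} (C : LinearCode n) (ε : ℝ) : ℝ :=
  (1 / (n : ℝ)) * ∑ i : Fin n, bitEntropy C ε i

/-- `z` covers `a`: the support of `a` is contained in the support of `z`. -/
def Covers {n : ℕ} (z a : Word n) : Prop := ∀ k, a k = 1 → z k = 1

/-- `z` covers some codeword `c ∈ C` with `(c_i, c_j) = (s, t)`, that is, `C^{ij}_{st}(z) ≠ ∅`. -/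
def CoversSome {n : ℕ} (C : LinearCode n) (i j : Fin n) (s t : ZMod 2) (z : Word n) : Prop :=
  ∃ c ∈ C, c i = s ∧ c j = t ∧ Covers z c

/-- The set `B₂^{ij}`. -/
def B2 {n : ℕ} (C : LinearCode n) (i j : Fin n) : Set (Word n) :=
  {z | CoversSome C i j 0 1 z ∧ ¬ CoversSome C i j 1 0 z ∧ ¬ CoversSome C i j 1 1 z}

/-- The set `B₃^{ij}`. -/
def B3 {n : ℕ} (C : LinearCode n) (i j : Fin n) : Set (Word n) :=
  {z | CoversSome C i j 1 0 z ∧ ¬ CoversSome C i j 0 1 z ∧ ¬ CoversSome C i j 1 1 z}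

/-- The set `B₄^{ij}`. -/
def B4 {n : ℕ} (C : LinearCode n) (i j : Fin n) : Set (Word n) :=
  {z | CoversSome C i j 1 1 z ∧ ¬ CoversSome C i j 0 1 z ∧ ¬ CoversSome C i j 1 0 z}

open Classical in
/-- The probability mass function of the random erasure pattern `Z^ε(ij)`: the coordinates `i` and
`j` equal `1`, all the others are independent Bernoulli(`ε`). -/
def patternPMF {n : ℕ} (ε : ℝ) (i j : Fin n) (z : Word n) : ℝ :=
  ∏ k, if k = i ∨ k = j then (if z k = 1 then 1 else 0) else (if z k = 1 then ε else 1 - ε)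

open Classical in
/-- `Pr(Z^ε(ij) ∈ A)`. -/
def patternProb {n : ℕ} (ε : ℝ) (i j : Fin n) (A : Set (Word n)) : ℝ :=
  ∑ z, if z ∈ A then patternPMF ε i j z else 0

/-- `α_{ij}^ε = Pr(Z^ε ∈ B₄ | Z^ε ∈ B₂ ∪ B₃ ∪ B₄)` (with value `0` if the conditioning event has
probability `0`). -/
def alpha {n : ℕ} (C : LinearCode n) (ε : ℝ) (i j : Fin n) : ℝ :=
  patternProb ε i j (B4 C i j) / patternProb ε i j (B2 C i j ∪ B3 C i j ∪ B4 C i j)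

end ExitBEC

end

/-!
Given the unerased outputs at the other positions, `X i` is either determined or an unbiased bit,
and which of the two happens depends only on the erasure pattern. Hence `bitEntropy C ε i` is the
probability `h` of the increasing event `undetermined C i`, a polynomial in `ε`. A position `j ≠ i`
is pivotal for this event exactly when the pattern with `i` and `j` erased lies in `B₄`, so by the
Margulis–Russo formula `h' = ∑ j ≠ i, Pr(Z ∈ B₄) = ∑ j ≠ i, α i j * Pr(Z ∈ B₂ ∪ B₃ ∪ B₄)`.

It remains to see that `Pr(Z ∈ B₂ ∪ B₃ ∪ B₄) ≥ h * (1 - h) / (8 * √n)`. Let `N` be the increasing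
event that the pair of bits `i`, `j` is not determined by `Z`. If `Z ∈ N` covers codewords `c`, `d`
with linearly independent pairs at `i`, `j`, then removing one position from `Z` keeps it in `N`,
since one of `c`, `d`, `c + d` vanishes there; so the inner boundary of `N` lies in
`B₂ ∪ B₃ ∪ B₄`, and its probability is at least `Pr N * (1 - Pr N) / (4 * √n)` by isoperimetry on
the cube. This suffices unless `Pr N` is much closer to `1` than `h`, and in that case the claim
follows from `Pr(Z ∈ B₂ ∪ B₃ ∪ B₄) ≥ Pr N - h`.
-/

noncomputable section

namespace ExitBEC

open Function

section ProductMeasure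

variable {ι : Type*} [Fintype ι]

/-- The probability that a Bernoulli bit with parameter `p` takes the value `b`. The parameter is
any real number, so that probabilities are polynomials that can be differentiated everywhere. -/
def bernoulliWeight (p : ℝ) (b : ZMod 2) : ℝ := if b = 1 then p else 1 - p

/-- The probability of the word `z` under independent Bernoulli bits with parameters `q k`. -/
def productWeight (q : ι → ℝ) (z : ι → ZMod 2) : ℝ := ∏ k, bernoulliWeight (q k) (z k)

lemma zmod_two_eq_zero_or_one (b : ZMod 2) : b = 0 ∨ b = 1 := by
  revert b; decide

lemma zmod_two_sum (f : ZMod 2 → ℝ) : ∑ b, f b = f 0 + f 1 := Fin.sum_univ_two f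

@[simp] lemma bernoulliWeight_one (p : ℝ) : bernoulliWeight p 1 = p := by
  simp [bernoulliWeight]

@[simp] lemma bernoulliWeight_zero (p : ℝ) : bernoulliWeight p 0 = 1 - p := by
  simp [bernoulliWeight]

lemma bernoulliWeight_nonneg {p : ℝ} (hp : p ∈ Set.Icc (0 : ℝ) 1) (b : ZMod 2) :
    0 ≤ bernoulliWeight p b := by
  unfold bernoulliWeight
  split_ifs
  exacts [hp.1, sub_nonneg.2 hp.2]

lemma sum_bernoulliWeight (p : ℝ) : ∑ b, bernoulliWeight p b = 1 := by
  simp [zmod_two_sum]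

lemma bernoulliWeight_zero_add_one (b : ZMod 2) :
    bernoulliWeight 0 (b + 1) = bernoulliWeight 1 b := by
  obtain rfl | rfl := zmod_two_eq_zero_or_one b <;> simp [CharTwo.add_self_eq_zero]

lemma bernoulliWeight_eq_convexCombination (t : ℝ) (b : ZMod 2) :
    bernoulliWeight t b = (1 - t) * bernoulliWeight 0 b + t * bernoulliWeight 1 b := by
  unfold bernoulliWeight
  split_ifs <;> ring

lemma hasDerivAt_bernoulliWeight (b : ZMod 2) (x : ℝ) :
    HasDerivAt (fun x => bernoulliWeight x b) (bernoulliWeight 1 b - bernoulliWeight 0 b) x := by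
  unfold bernoulliWeight
  split_ifs
  · simpa using hasDerivAt_id' x
  · simpa using (hasDerivAt_id' x).const_sub 1

lemma productWeight_nonneg {q : ι → ℝ} (hq : ∀ k, q k ∈ Set.Icc (0 : ℝ) 1) (z : ι → ZMod 2) :
    0 ≤ productWeight q z :=
  Finset.prod_nonneg fun k _ => bernoulliWeight_nonneg (hq k) _

variable [DecidableEq ι]

lemma sum_productWeight (q : ι → ℝ) : ∑ z, productWeight q z = 1 := by
  simp only [productWeight, ← Fintype.prod_sum fun k b => bernoulliWeight (q k) b,
    sum_bernoulliWeight, Finset.prod_const_one]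

lemma productWeight_update (q : ι → ℝ) (j : ι) (t : ℝ) (z : ι → ZMod 2) :
    productWeight (update q j t) z =
      bernoulliWeight t (z j) * ∏ k ∈ Finset.univ.erase j, bernoulliWeight (q k) (z k) := by
  rw [productWeight, ← Finset.mul_prod_erase _ _ (Finset.mem_univ j), update_self]
  congr 1
  exact Finset.prod_congr rfl fun k hk => by rw [update_of_ne (Finset.ne_of_mem_erase hk)]

lemma productWeight_update_eq_convexCombination (q : ι → ℝ) (j : ι) (t : ℝ) (z : ι → ZMod 2) :
    productWeight (update q j t) z =
      (1 - t) * productWeight (update q j 0) z + t * productWeight (update q j 1) z := by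
  simp only [productWeight_update, bernoulliWeight_eq_convexCombination t]
  ring

lemma productWeight_update_zero_add_single (q : ι → ℝ) (j : ι) (z : ι → ZMod 2) :
    productWeight (update q j 0) (z + Pi.single j 1) = productWeight (update q j 1) z := by
  rw [productWeight_update, productWeight_update, Pi.add_apply, Pi.single_eq_same,
    bernoulliWeight_zero_add_one]
  congr 1
  exact Finset.prod_congr rfl fun k hk => by simp [Finset.ne_of_mem_erase hk]

lemma hasDerivAt_productWeight (z : ι → ZMod 2) (x : ℝ) :
    HasDerivAt (fun x => productWeight (fun _ => x) z)
      (∑ j, (productWeight (update (fun _ => x) j 1) z -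
        productWeight (update (fun _ => x) j 0) z)) x := by
  refine (HasDerivAt.fun_finsetProd fun k _ =>
    hasDerivAt_bernoulliWeight (z k) x).congr_deriv (Finset.sum_congr rfl fun j _ => ?_)
  rw [productWeight_update, productWeight_update, smul_eq_mul]
  ring

/-- The probability of the event `A` under independent Bernoulli bits with parameters `q k`. -/
def productProb (q : ι → ℝ) (A : Set (ι → ZMod 2)) : ℝ := ∑ z, A.indicator (productWeight q) z

section Events

variable {q : ι → ℝ} (hq : ∀ k, q k ∈ Set.Icc (0 : ℝ) 1)
include hq

lemma productProb_nonneg (A : Set (ι → ZMod 2)) : 0 ≤ productProb q A :=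
  Finset.sum_nonneg fun _ _ => Set.indicator_nonneg (fun z _ => productWeight_nonneg hq z) _

lemma productProb_mono {A B : Set (ι → ZMod 2)} (h : A ⊆ B) :
    productProb q A ≤ productProb q B :=
  Finset.sum_le_sum fun z _ =>
    Set.indicator_le_indicator_of_subset h (productWeight_nonneg hq) z

lemma productProb_le_one (A : Set (ι → ZMod 2)) : productProb q A ≤ 1 := by
  rw [← sum_productWeight q]
  exact Finset.sum_le_sum fun z _ => Set.indicator_le_self' (fun z _ => productWeight_nonneg hq z) z

lemma productProb_union_le (A B : Set (ι → ZMod 2)) :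
    productProb q (A ∪ B) ≤ productProb q A + productProb q B := by
  rw [productProb, productProb, productProb, ← Finset.sum_add_distrib]
  refine Finset.sum_le_sum fun z _ => ?_
  rw [← Set.indicator_union_add_inter_apply]
  exact le_add_of_nonneg_right (Set.indicator_nonneg (fun z _ => productWeight_nonneg hq z) _)

end Events

lemma productProb_sdiff (q : ι → ℝ) {A B : Set (ι → ZMod 2)} (h : B ⊆ A) :
    productProb q (A \ B) = productProb q A - productProb q B := by
  simp only [productProb, Set.indicator_sdiff h, Pi.sub_apply, Finset.sum_sub_distrib]

lemma productProb_comp_perm (q : ι → ℝ) (π : Equiv.Perm ι) (A : Set (ι → ZMod 2)) :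
    productProb q ((fun z => z ∘ π) ⁻¹' A) = productProb (q ∘ π) A := by
  refine Fintype.sum_equiv (Equiv.arrowCongr π.symm (Equiv.refl (ZMod 2))) _ _ fun z => ?_
  have hz : Equiv.arrowCongr π.symm (Equiv.refl (ZMod 2)) z = z ∘ π := by
    ext k
    simp
  have hweight : productWeight (q ∘ π) (z ∘ π) = productWeight q z :=
    Equiv.prod_comp π fun k => bernoulliWeight (q k) (z k)
  classical
  simp only [hz, Set.indicator_apply, Set.mem_preimage, hweight]

lemma productProb_eq_convexCombination (q : ι → ℝ) (j : ι) (A : Set (ι → ZMod 2)) :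
    productProb q A =
      (1 - q j) * productProb (update q j 0) A + q j * productProb (update q j 1) A := by
  classical
  simp only [productProb, Set.indicator_apply, Finset.mul_sum, ← Finset.sum_add_distrib]
  refine Finset.sum_congr rfl fun z _ => ?_
  split_ifs
  · rw [← productWeight_update_eq_convexCombination, update_eq_self]
  · ring

lemma productProb_update_of_invariant (q : ι → ℝ) {j : ι} {A : Set (ι → ZMod 2)}
    (hA : ∀ z b, update z j b ∈ A ↔ z ∈ A) (t : ℝ) :
    productProb (update q j t) A = productProb q A := by
  have flip_mem (z : ι → ZMod 2) : z + Pi.single j 1 ∈ A ↔ z ∈ A := by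
    rw [← hA (z + Pi.single j 1) (z j), ← hA z (z j)]
    congr! 1
    rw [update_eq_iff]
    simp +contextual
  have flip : productProb (update q j 0) A = productProb (update q j 1) A := by
    classical
    refine (Fintype.sum_equiv (Equiv.addRight (Pi.single j (1 : ZMod 2))) _ _ fun z => ?_).symm
    simp only [Set.indicator_apply, Equiv.coe_addRight, flip_mem,
      productWeight_update_zero_add_single]
  rw [productProb_eq_convexCombination _ j, productProb_eq_convexCombination q j]
  simp only [update_idem, update_self, flip]
  ring

lemma productProb_update_of_weight_eq_zero (q : ι → ℝ) (j : ι) {t : ℝ} {b : ZMod 2}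
    (ht : ∀ c ≠ b, bernoulliWeight t c = 0) (A : Set (ι → ZMod 2)) :
    productProb (update q j t) A = productProb q ((fun z => update z j b) ⁻¹' A) := by
  rw [← productProb_update_of_invariant q (j := j) (by simp) t]
  classical
  refine Finset.sum_congr rfl fun z _ => ?_
  by_cases hz : z j = b
  · simp [Set.indicator_apply, ← hz]
  · simp [Set.indicator_apply, productWeight_update, ht _ hz]

lemma productProb_update_zero (q : ι → ℝ) (j : ι) (A : Set (ι → ZMod 2)) :
    productProb (update q j 0) A = productProb q ((fun z => update z j 0) ⁻¹' A) :=
  productProb_update_of_weight_eq_zero q j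
    (fun c hc => by simp [(zmod_two_eq_zero_or_one c).resolve_left hc]) A

lemma productProb_update_one (q : ι → ℝ) (j : ι) (A : Set (ι → ZMod 2)) :
    productProb (update q j 1) A = productProb q ((fun z => update z j 1) ⁻¹' A) :=
  productProb_update_of_weight_eq_zero q j
    (fun c hc => by simp [(zmod_two_eq_zero_or_one c).resolve_right hc]) A

lemma productProb_eq_zero_or_one {q : ι → ℝ} (hq : ∀ k, q k = 0 ∨ q k = 1)
    (A : Set (ι → ZMod 2)) : productProb q A = 0 ∨ productProb q A = 1 := by
  have hpoint (k : ι) : ∃ b : ZMod 2, ∀ c, bernoulliWeight (q k) c = if c = b then 1 else 0 := by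
    rcases hq k with h | h
    · exact ⟨0, fun c => by obtain rfl | rfl := zmod_two_eq_zero_or_one c <;> simp [h]⟩
    · exact ⟨1, fun c => by obtain rfl | rfl := zmod_two_eq_zero_or_one c <;> simp [h]⟩
  choose w hw using hpoint
  have hweight (z : ι → ZMod 2) : productWeight q z = if z = w then 1 else 0 := by
    simp only [productWeight, hw, Fintype.prod_boole, funext_iff]
  have hprob : productProb q A = A.indicator 1 w := by
    rw [productProb, Finset.sum_eq_single w (fun z _ hz => by simp [hweight, hz]) (by simp)]
    classical
    simp [Set.indicator_apply, hweight]
  rw [hprob]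
  exact Set.indicator_eq_zero_or_self A 1 w

/-- The Margulis–Russo formula. -/
lemma hasDerivAt_productProb (A : Set (ι → ZMod 2)) (x : ℝ) :
    HasDerivAt (fun x => productProb (fun _ => x) A)
      (∑ j, (productProb (update (fun _ => x) j 1) A -
        productProb (update (fun _ => x) j 0) A)) x := by
  have hterm (z : ι → ZMod 2) : HasDerivAt (fun x => A.indicator (productWeight fun _ => x) z)
      (∑ j, (A.indicator (productWeight (update (fun _ => x) j 1)) z -
        A.indicator (productWeight (update (fun _ => x) j 0)) z)) x := by
    by_cases hz : z ∈ A
    · simpa only [Set.indicator_of_mem hz] using hasDerivAt_productWeight z x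
    · simpa [Set.indicator_of_notMem hz] using hasDerivAt_const x (0 : ℝ)
  have h := HasDerivAt.fun_sum (u := Finset.univ) fun z _ => hterm z
  rw [Finset.sum_comm] at h
  simpa only [productProb, Finset.sum_sub_distrib] using h

end ProductMeasure

section Isoperimetry

lemma div_le_div_of_variance_gap {s S v w : ℝ} (hs : 1 ≤ s) (hS : 0 < S)
    (hsS : S ^ 2 = s ^ 2 + 1) (hw : 0 ≤ w) (hwv : 4 * w * s ^ 2 ≤ v) : v / S ≤ (v - w) / s := by
  have hS_add : S * (S + s) ≤ 4 * s ^ 2 := by nlinarith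
  have hgain : w * S * (S + s) ≤ v * (S - s) * (S + s) := by
    calc w * S * (S + s) = w * (S * (S + s)) := by ring
      _ ≤ w * (4 * s ^ 2) := by gcongr
      _ ≤ v := by linarith
      _ = v * (S - s) * (S + s) := by linear_combination -v * hsS
  have : w * S ≤ v * (S - s) := le_of_mul_le_mul_right hgain (by linarith)
  rw [div_le_div_iff₀ hS (by linarith)]
  linarith

lemma variance_le_of_large_jump {s p a t v : ℝ} (hs : 1 ≤ s) (hp₀ : 0 ≤ p) (hp₁ : p ≤ 1)
    (ha : 0 ≤ a) (ht : 0 ≤ t) (hat : a + t ≤ 1) (hv : v = (a + p * t) * (1 - (a + p * t)))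
    (hjump : v ≤ (t * s) ^ 2) :
    v ≤ (1 - p) * (a * (1 - a)) + 4 * s * (p * t) := by
  have hpt : p * t ≤ t := mul_le_of_le_one_left ht hp₁
  have hv_nonneg : 0 ≤ v := hv ▸ mul_nonneg (by positivity) (by linarith)
  have hv_le : 4 * v ≤ 1 := by
    rw [hv]
    linarith [sq_nonneg (1 - 2 * (a + p * t))]
  have hv_jump : 2 * v ≤ t * s := by
    refine le_of_sq_le_sq ?_ (by positivity)
    nlinarith
  have hts : t ≤ t * s := le_mul_of_one_le_right ht hs
  have hcond : (a + t) * (1 - (a + t)) + (1 - p) * t ^ 2 ≤ v + t := by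
    have : 0 ≤ (1 - p) * t * (2 * a + p * t) := by
      have : 0 ≤ 1 - p := sub_nonneg.2 hp₁
      positivity
    rw [hv]
    linarith [mul_nonneg hp₀ ht]
  calc v = (1 - p) * (a * (1 - a)) + p * ((a + t) * (1 - (a + t)) + (1 - p) * t ^ 2) := by
        rw [hv]
        ring
    _ ≤ (1 - p) * (a * (1 - a)) + p * (4 * (t * s)) := by
        gcongr
        linarith
    _ = (1 - p) * (a * (1 - a)) + 4 * s * (p * t) := by ring

/-- The inductive step of the isoperimetric inequality on the cube, with `s = √m` and `S = √(m+1)`: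
`a₀`, `a₁` are the probabilities of the two halves of the event and `d₀`, `d₁` those of the halves
of its boundary. -/
lemma two_point_inequality {s S p a₀ a₁ d₀ d₁ : ℝ} (hs : 1 ≤ s) (hS : 0 < S)
    (hsS : S ^ 2 = s ^ 2 + 1) (hp₀ : 0 ≤ p) (hp₁ : p ≤ 1) (ha₀ : 0 ≤ a₀) (ha : a₀ ≤ a₁)
    (ha₁ : a₁ ≤ 1) (hd₀ : a₀ * (1 - a₀) / (4 * s) ≤ d₀) (hd₁ : a₁ * (1 - a₁) / (4 * s) ≤ d₁)
    (hd : a₁ - a₀ ≤ d₁) :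
    ((1 - p) * a₀ + p * a₁) * (1 - ((1 - p) * a₀ + p * a₁)) / (4 * S) ≤
      (1 - p) * d₀ + p * d₁ := by
  obtain ⟨t, rfl⟩ : ∃ t, a₁ = a₀ + t := ⟨a₁ - a₀, by ring⟩
  rw [add_sub_cancel_left] at hd
  have ht : 0 ≤ t := by linarith
  have : 0 ≤ 1 - p := sub_nonneg.2 hp₁
  have : 0 < s := by linarith
  have hmean : (1 - p) * a₀ + p * (a₀ + t) = a₀ + p * t := by ring
  rw [hmean]
  obtain ⟨v, hv⟩ : ∃ v, v = (a₀ + p * t) * (1 - (a₀ + p * t)) := ⟨_, rfl⟩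
  rw [← hv]
  rcases le_total ((t * s) ^ 2) v with hsmall | hlarge
  · have htotal : v - p * (1 - p) * t ^ 2 =
        (1 - p) * (a₀ * (1 - a₀)) + p * ((a₀ + t) * (1 - (a₀ + t))) := by
      rw [hv]
      ring
    have hgap : 4 * (p * (1 - p) * t ^ 2) * s ^ 2 ≤ v := by
      nlinarith [mul_nonneg (sq_nonneg (1 - 2 * p)) (sq_nonneg (t * s))]
    calc v / (4 * S) = v / S / 4 := by rw [mul_comm, div_div]
      _ ≤ (v - p * (1 - p) * t ^ 2) / s / 4 := by
          gcongr ?_ / 4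
          exact div_le_div_of_variance_gap hs hS hsS (by positivity) hgap
      _ = (1 - p) * (a₀ * (1 - a₀) / (4 * s)) + p * ((a₀ + t) * (1 - (a₀ + t)) / (4 * s)) := by
          rw [htotal]
          ring
      _ ≤ (1 - p) * d₀ + p * d₁ := by gcongr
  · have hsS_le : s ≤ S := by nlinarith
    have hvar := variance_le_of_large_jump hs hp₀ hp₁ ha₀ ht ha₁ hv hlarge
    calc v / (4 * S) ≤ ((1 - p) * (a₀ * (1 - a₀)) + 4 * s * (p * t)) / (4 * S) := by gcongr
      _ ≤ ((1 - p) * (a₀ * (1 - a₀)) + 4 * s * (p * t)) / (4 * s) := by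
          have : 0 ≤ 1 - a₀ := by linarith
          gcongr
      _ = (1 - p) * (a₀ * (1 - a₀) / (4 * s)) + p * t := by field_simp
      _ ≤ (1 - p) * d₀ + p * d₁ := by gcongr

variable {ι : Type*} [DecidableEq ι]

/-- Increasing events of the cube: turning a coordinate from `0` to `1` preserves membership. -/
def IsIncreasing (A : Set (ι → ZMod 2)) : Prop := ∀ z k, update z k 0 ∈ A → update z k 1 ∈ A

/-- The inner vertex boundary of an increasing event: its members that leave it when some
coordinate is set to `0`. -/
def innerBoundary (A : Set (ι → ZMod 2)) : Set (ι → ZMod 2) := {z | z ∈ A ∧ ∃ k, update z k 0 ∉ A}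

lemma update_mem_Icc {q : ι → ℝ} (hq : ∀ k, q k ∈ Set.Icc (0 : ℝ) 1) (j : ι) {t : ℝ}
    (ht : t ∈ Set.Icc (0 : ℝ) 1) (k : ι) : update q j t k ∈ Set.Icc (0 : ℝ) 1 := by
  rw [update_apply]
  split_ifs
  exacts [ht, hq k]

variable [Fintype ι] {q : ι → ℝ}

lemma productProb_update_zero_le_update_one (hq : ∀ k, q k ∈ Set.Icc (0 : ℝ) 1)
    {A : Set (ι → ZMod 2)} (hA : IsIncreasing A) (j : ι) :
    productProb (update q j 0) A ≤ productProb (update q j 1) A := by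
  rw [productProb_update_zero, productProb_update_one]
  exact productProb_mono hq fun z => hA z j

lemma productProb_update_one_sub_update_zero_le (hq : ∀ k, q k ∈ Set.Icc (0 : ℝ) 1)
    (A : Set (ι → ZMod 2)) (j : ι) :
    productProb (update q j 1) A - productProb (update q j 0) A ≤
      productProb (update q j 1) (innerBoundary A) := by
  rw [sub_le_iff_le_add', productProb_update_one, productProb_update_zero, productProb_update_one]
  refine (productProb_mono hq fun z hz => ?_).trans (productProb_union_le hq _ _)
  by_cases h0 : update z j 0 ∈ A
  · exact Or.inl h0
  · exact Or.inr ⟨hz, j, by rwa [update_idem]⟩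

/-- A vertex isoperimetric inequality on the cube, uniform in the product measure: only the number
of coordinates that are really random enters. -/
theorem IsIncreasing.variance_div_sqrt_le_innerBoundary {A : Set (ι → ZMod 2)}
    (hA : IsIncreasing A) (hq : ∀ k, q k ∈ Set.Icc (0 : ℝ) 1) (s : Finset ι)
    (hs : ∀ k ∉ s, q k = 0 ∨ q k = 1) :
    productProb q A * (1 - productProb q A) / (4 * √(s.card + 1)) ≤
      productProb q (innerBoundary A) := by
  induction s using Finset.induction_on generalizing q with
  | empty =>
    have h : productProb q A * (1 - productProb q A) = 0 := by
      rcases productProb_eq_zero_or_one (fun k => hs k (Finset.notMem_empty k)) A with h | h <;>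
        simp [h]
    rw [h, zero_div]
    exact productProb_nonneg hq _
  | insert j s hj ih =>
    have slice {t : ℝ} (ht : t = 0 ∨ t = 1) := by
      have hmem : t ∈ Set.Icc (0 : ℝ) 1 := by rcases ht with rfl | rfl <;> simp
      refine ih (update_mem_Icc hq j hmem) fun k hk => ?_
      rcases eq_or_ne k j with rfl | hkj
      · rwa [update_self]
      · rw [update_of_ne hkj]
        exact hs k (by simp [hk, hkj])
    have hq₀ := update_mem_Icc hq j (t := 0) (by simp)
    have hq₁ := update_mem_Icc hq j (t := 1) (by simp)
    rw [productProb_eq_convexCombination q j A,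
      productProb_eq_convexCombination q j (innerBoundary A)]
    refine two_point_inequality (s := √(s.card + 1)) ?_ (by positivity) ?_ (hq j).1 (hq j).2
      (productProb_nonneg hq₀ A) (productProb_update_zero_le_update_one hq hA j)
      (productProb_le_one hq₁ A) (slice (Or.inl rfl)) (slice (Or.inr rfl))
      (productProb_update_one_sub_update_zero_le hq A j)
    · rw [Real.one_le_sqrt, le_add_iff_nonneg_left]
      positivity
    · rw [Real.sq_sqrt (by positivity), Real.sq_sqrt (by positivity),
        Finset.card_insert_of_notMem hj, Nat.cast_add_one]

end Isoperimetry

section Codes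

variable {n : ℕ} {C : LinearCode n} {i j : Fin n} {z z' a b : Word n}

lemma Covers.add (ha : Covers z a) (hb : Covers z b) : Covers z (a + b) := by
  intro k hk
  rcases zmod_two_eq_zero_or_one (a k) with h | h
  · exact hb k (by simpa [h] using hk)
  · exact ha k h

lemma Covers.trans (hz : Covers z' z) (ha : Covers z a) : Covers z' a := fun k hk => hz k (ha k hk)

lemma covers_update_one (z : Word n) (k : Fin n) : Covers (update z k 1) z := by
  intro l hl
  rcases eq_or_ne l k with rfl | hlk <;> simp [*]

lemma covers_update_zero_iff {k : Fin n} :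
    Covers (update z k 0) a ↔ a k = 0 ∧ Covers (update z k 1) a := by
  refine ⟨fun h => ⟨?_, fun l hl => ?_⟩, fun h l hl => ?_⟩
  · exact (zmod_two_eq_zero_or_one _).resolve_right fun hk => by simpa using h k hk
  · rcases eq_or_ne l k with rfl | hlk
    · simp
    · simpa [hlk] using h l hl
  · have hlk : l ≠ k := by
      rintro rfl
      simp [hl] at h
    simpa [hlk] using h.2 l hl

lemma CoversSome.add {s t s' t' : ZMod 2} (h : CoversSome C i j s t z)
    (h' : CoversSome C i j s' t' z) : CoversSome C i j (s + s') (t + t') z := by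
  obtain ⟨c, hc, rfl, rfl, hz⟩ := h
  obtain ⟨c', hc', rfl, rfl, hz'⟩ := h'
  exact ⟨c + c', C.add_mem hc hc', rfl, rfl, hz.add hz'⟩

/-- The erasure patterns that leave the bit `i` undetermined by the other unerased bits: some
codeword with `c i = 1` is supported on the erased positions together with `i`. -/
def undetermined (C : LinearCode n) (i : Fin n) : Set (Word n) :=
  {z | ∃ c ∈ C, c i = 1 ∧ Covers (update z i 1) c}

/-- The patterns that leave the pair of bits `i`, `j` undetermined. -/
def coversNonzero (C : LinearCode n) (i j : Fin n) : Set (Word n) :=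
  {z | ∃ c ∈ C, (c i = 1 ∨ c j = 1) ∧ Covers z c}

/-- The patterns for which the pairs `(c i, c j)` of covered codewords form a one-dimensional
space. -/
def rankOne (C : LinearCode n) (i j : Fin n) : Set (Word n) := B2 C i j ∪ B3 C i j ∪ B4 C i j

lemma mem_coversNonzero_iff : z ∈ coversNonzero C i j ↔
    CoversSome C i j 0 1 z ∨ CoversSome C i j 1 0 z ∨ CoversSome C i j 1 1 z := by
  constructor
  · rintro ⟨c, hc, h, hz⟩
    rcases zmod_two_eq_zero_or_one (c i) with hi | hi
    · exact Or.inl ⟨c, hc, hi, h.resolve_left (by simp [hi]), hz⟩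
    · rcases zmod_two_eq_zero_or_one (c j) with hj | hj
      · exact Or.inr (Or.inl ⟨c, hc, hi, hj, hz⟩)
      · exact Or.inr (Or.inr ⟨c, hc, hi, hj, hz⟩)
  · rintro (⟨c, hc, -, hj, hz⟩ | ⟨c, hc, hi, -, hz⟩ | ⟨c, hc, hi, -, hz⟩)
    exacts [⟨c, hc, Or.inr hj, hz⟩, ⟨c, hc, Or.inl hi, hz⟩, ⟨c, hc, Or.inl hi, hz⟩]

/-- A pattern has rank two as soon as two of the three nonzero pairs occur, and then all three
occur. -/
lemma mem_rankOne_iff : z ∈ rankOne C i j ↔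
    z ∈ coversNonzero C i j ∧ ¬ (CoversSome C i j 0 1 z ∧ CoversSome C i j 1 0 z) := by
  have h01 : CoversSome C i j 1 0 z → CoversSome C i j 1 1 z → CoversSome C i j 0 1 z :=
    CoversSome.add
  have h10 : CoversSome C i j 0 1 z → CoversSome C i j 1 1 z → CoversSome C i j 1 0 z :=
    CoversSome.add
  have h11 : CoversSome C i j 0 1 z → CoversSome C i j 1 0 z → CoversSome C i j 1 1 z :=
    CoversSome.add
  rw [mem_coversNonzero_iff]
  simp only [rankOne, B2, B3, B4, Set.mem_union, Set.mem_ofPred_eq]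
  tauto

lemma isIncreasing_coversNonzero : IsIncreasing (coversNonzero C i j) := by
  rintro z k ⟨c, hc, hne, hz⟩
  exact ⟨c, hc, hne, (covers_update_zero_iff.1 hz).2⟩

lemma innerBoundary_coversNonzero_subset_rankOne :
    innerBoundary (coversNonzero C i j) ⊆ rankOne C i j := by
  rintro z ⟨hz, k, hk⟩
  refine mem_rankOne_iff.2 ⟨hz, ?_⟩
  rintro ⟨⟨c, hc, hci, hcj, hzc⟩, ⟨d, hd, hdi, -, hzd⟩⟩
  -- One of the codewords `c`, `d`, `c + d` vanishes at `k`.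
  have survives {e : Word n} (he : e ∈ C) (hne : e i = 1 ∨ e j = 1) (hze : Covers z e) :
      e k = 1 :=
    (zmod_two_eq_zero_or_one _).resolve_left fun hek =>
      hk ⟨e, he, hne, covers_update_zero_iff.2 ⟨hek, (covers_update_one z k).trans hze⟩⟩
  have hck := survives hc (Or.inr hcj) hzc
  have hdk := survives hd (Or.inl hdi) hzd
  have hcdk := survives (C.add_mem hc hd) (Or.inl (by simp [hci, hdi])) (hzc.add hzd)
  rw [Pi.add_apply, hck, hdk, CharTwo.add_self_eq_zero] at hcdk
  exact zero_ne_one hcdk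

/-- The pattern `z` with the positions `i` and `j` erased. -/
def forceOnes (i j : Fin n) (z : Word n) : Word n := update (update z j 1) i 1

lemma update_one_mem_undetermined_iff : update z j 1 ∈ undetermined C i ↔
    CoversSome C i j 1 0 (forceOnes i j z) ∨ CoversSome C i j 1 1 (forceOnes i j z) := by
  constructor
  · rintro ⟨c, hc, hi, hz⟩
    exact (zmod_two_eq_zero_or_one (c j)).imp (⟨c, hc, hi, ·, hz⟩) (⟨c, hc, hi, ·, hz⟩)
  · rintro (⟨c, hc, hi, -, hz⟩ | ⟨c, hc, hi, -, hz⟩) <;> exact ⟨c, hc, hi, hz⟩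

lemma update_zero_mem_undetermined_iff (hij : i ≠ j) :
    update z j 0 ∈ undetermined C i ↔ CoversSome C i j 1 0 (forceOnes i j z) := by
  have hcovers (c : Word n) : Covers (update (update z j 0) i 1) c ↔
      c j = 0 ∧ Covers (forceOnes i j z) c := by
    rw [forceOnes, update_comm hij.symm, update_comm hij.symm, covers_update_zero_iff]
  simp only [undetermined, CoversSome, Set.mem_ofPred_eq, hcovers]

lemma preimage_forceOnes_B4 (hij : i ≠ j) :
    forceOnes i j ⁻¹' B4 C i j =
      (update · j 1) ⁻¹' undetermined C i \ (update · j 0) ⁻¹' undetermined C i := by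
  ext z
  have h10 : CoversSome C i j 0 1 (forceOnes i j z) → CoversSome C i j 1 1 (forceOnes i j z) →
      CoversSome C i j 1 0 (forceOnes i j z) := CoversSome.add
  simp only [B4, Set.mem_preimage, Set.mem_ofPred_eq, Set.mem_sdiff,
    update_one_mem_undetermined_iff, update_zero_mem_undetermined_iff hij]
  tauto

lemma isIncreasing_undetermined : IsIncreasing (undetermined C i) := by
  rintro z k ⟨c, hc, hi, hz⟩
  refine ⟨c, hc, hi, Covers.trans (fun l hl => ?_) hz⟩
  revert hl
  simp only [update_apply]
  split_ifs <;> simp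

lemma update_self_mem_undetermined_iff (z : Word n) (b : ZMod 2) :
    update z i b ∈ undetermined C i ↔ z ∈ undetermined C i := by
  simp only [undetermined, Set.mem_ofPred_eq, update_idem]

lemma patternProb_eq (ε : ℝ) (i j : Fin n) (A : Set (Word n)) :
    patternProb ε i j A = productProb (update (update (fun _ => ε) j 1) i 1) A := by
  classical
  have hweight (z : Word n) : patternPMF ε i j z =
      productWeight (update (update (fun _ => ε) j 1) i 1) z := by
    refine Finset.prod_congr rfl fun k _ => ?_
    simp only [bernoulliWeight, update_apply]
    split_ifs <;> first | rfl | simp_all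
  simp only [patternProb, productProb, hweight, Set.indicator_apply]

lemma patternProb_eq_productProb_preimage (ε : ℝ) (i j : Fin n) (A : Set (Word n)) :
    patternProb ε i j A = productProb (fun _ => ε) (forceOnes i j ⁻¹' A) := by
  rw [patternProb_eq, productProb_update_one, productProb_update_one]
  rfl

lemma hasDerivAt_productProb_undetermined (C : LinearCode n) (i : Fin n) (ε : ℝ) :
    HasDerivAt (fun ε => productProb (fun _ => ε) (undetermined C i))
      (∑ j ∈ Finset.univ.erase i, patternProb ε i j (B4 C i j)) ε := by
  refine (hasDerivAt_productProb (undetermined C i) ε).congr_deriv ?_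
  have hself : productProb (update (fun _ => ε) i 1) (undetermined C i) -
      productProb (update (fun _ => ε) i 0) (undetermined C i) = 0 := by
    simp only [productProb_update_of_invariant _ update_self_mem_undetermined_iff, sub_self]
  rw [← Finset.add_sum_erase _ _ (Finset.mem_univ i), hself, zero_add]
  refine Finset.sum_congr rfl fun j hj => ?_
  have hsubset : (update · j 0) ⁻¹' undetermined C i ⊆ (update · j 1) ⁻¹' undetermined C i :=
    fun z hz => isIncreasing_undetermined z j hz
  rw [patternProb_eq_productProb_preimage, preimage_forceOnes_B4 (Finset.ne_of_mem_erase hj).symm,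
    productProb_sdiff _ hsubset, productProb_update_one, productProb_update_zero]

lemma preimage_comp_undetermined {π : Equiv.Perm (Fin n)} (hπ : ∀ x : Word n, x ∘ π ∈ C ↔ x ∈ C) :
    (fun z => z ∘ π) ⁻¹' undetermined C i = undetermined C (π i) := by
  have hcovers (z c : Word n) :
      Covers (update (z ∘ π) i 1) (c ∘ π) ↔ Covers (update z (π i) 1) c := by
    have hz : update (z ∘ π) i 1 = update z (π i) 1 ∘ π :=
      (update_comp_eq_of_injective z π.injective i 1).symm
    rw [hz]
    exact π.forall_congr_right (q := fun k => c k = 1 → update z (π i) 1 k = 1)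
  ext z
  constructor
  · rintro ⟨c, hc, hi, hz⟩
    obtain ⟨c, rfl⟩ := π.injective.surjective_comp_right c
    exact ⟨c, (hπ c).1 hc, hi, (hcovers z c).1 hz⟩
  · rintro ⟨c, hc, hi, hz⟩
    exact ⟨c ∘ π, (hπ c).2 hc, hi, (hcovers z c).2 hz⟩

lemma productProb_undetermined_eq (hC : OneTransitive C) (ε : ℝ) (i j : Fin n) :
    productProb (fun _ => ε) (undetermined C i) = productProb (fun _ => ε) (undetermined C j) := by
  obtain ⟨π, rfl, hπ⟩ := hC i j
  rw [← preimage_comp_undetermined hπ, productProb_comp_perm]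
  rfl

end Codes

section RankOne

variable {n : ℕ} {C : LinearCode n} {ε : ℝ} {i j : Fin n}

lemma variance_div_le_of_le_add {r g a d : ℝ} (hr : 1 ≤ r) (hg : 0 ≤ g) (hga : g ≤ a) (ha : a ≤ 1)
    (had : a ≤ g + d) (hd : a * (1 - a) / (4 * r) ≤ d) : g * (1 - g) / (8 * r) ≤ d := by
  rcases le_total a ((1 + g) / 2) with h | h
  · refine le_trans ?_ hd
    rw [div_le_div_iff₀ (by linarith) (by linarith)]
    have : g * (1 - g) ≤ 2 * (a * (1 - a)) := by nlinarith
    nlinarith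
  · calc g * (1 - g) / (8 * r) ≤ g * (1 - g) / 8 := by
          gcongr
          · nlinarith
          · linarith
      _ ≤ d := by nlinarith

lemma undetermined_subset_preimage_coversNonzero :
    undetermined C i ⊆ forceOnes i j ⁻¹' coversNonzero C i j := by
  rintro z ⟨c, hc, hi, hz⟩
  refine ⟨c, hc, Or.inl hi, fun k hk => ?_⟩
  have := hz k hk
  simp only [forceOnes, update_apply] at this ⊢
  split_ifs at this ⊢ <;> trivial

lemma preimage_coversNonzero_subset (hij : i ≠ j) :
    forceOnes i j ⁻¹' coversNonzero C i j ⊆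
      undetermined C i ∪ forceOnes i j ⁻¹' rankOne C i j := by
  intro z hz
  by_cases h10 : CoversSome C i j 1 0 (forceOnes i j z)
  · have h0 := (update_zero_mem_undetermined_iff hij).2 h10
    refine Or.inl ?_
    rcases zmod_two_eq_zero_or_one (z j) with h | h
    · rwa [← update_eq_self j z, h]
    · rw [← update_eq_self j z, h]
      exact isIncreasing_undetermined z j h0
  · exact Or.inr (mem_rankOne_iff.2 ⟨hz, fun h => h10 h.2⟩)

lemma variance_undetermined_div_sqrt_le_rankOne (hε : ε ∈ Set.Icc (0 : ℝ) 1) (hij : i ≠ j) :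
    productProb (fun _ => ε) (undetermined C i) *
        (1 - productProb (fun _ => ε) (undetermined C i)) / (8 * √n) ≤
      patternProb ε i j (rankOne C i j) := by
  have hconst (k : Fin n) : (fun _ => ε) k ∈ Set.Icc (0 : ℝ) 1 := hε
  have hone : (1 : ℝ) ∈ Set.Icc (0 : ℝ) 1 := by simp
  have hq := update_mem_Icc (update_mem_Icc hconst j hone) i hone
  have hcard : ((Finset.univ.erase i).card + 1 : ℝ) = n := by
    exact_mod_cast (Finset.card_erase_add_one (Finset.mem_univ i)).trans (Finset.card_fin n)
  have hiso := (isIncreasing_coversNonzero (C := C) (i := i)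
    (j := j)).variance_div_sqrt_le_innerBoundary hq (Finset.univ.erase i) fun k hk => by simp_all
  rw [hcard] at hiso
  refine variance_div_le_of_le_add (a := patternProb ε i j (coversNonzero C i j)) ?_
    (productProb_nonneg hconst _) ?_ ?_ ?_ ?_
  · rw [Real.one_le_sqrt]
    exact_mod_cast i.pos
  · rw [patternProb_eq_productProb_preimage]
    exact productProb_mono hconst undetermined_subset_preimage_coversNonzero
  · rw [patternProb_eq]
    exact productProb_le_one hq _
  · simp only [patternProb_eq_productProb_preimage]
    exact (productProb_mono hconst (preimage_coversNonzero_subset hij)).trans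
      (productProb_union_le hconst _ _)
  · simp only [patternProb_eq]
    exact hiso.trans (productProb_mono hq innerBoundary_coversNonzero_subset_rankOne)

lemma patternProb_nonneg (hε : ε ∈ Set.Icc (0 : ℝ) 1) (i j : Fin n) (A : Set (Word n)) :
    0 ≤ patternProb ε i j A := by
  rw [patternProb_eq_productProb_preimage]
  exact productProb_nonneg (fun _ => hε) _

lemma patternProb_mono (hε : ε ∈ Set.Icc (0 : ℝ) 1) (i j : Fin n) {A B : Set (Word n)}
    (h : A ⊆ B) : patternProb ε i j A ≤ patternProb ε i j B := by
  simp only [patternProb_eq_productProb_preimage]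
  exact productProb_mono (fun _ => hε) (Set.preimage_mono h)

lemma alpha_nonneg (hε : ε ∈ Set.Icc (0 : ℝ) 1) (C : LinearCode n) (i j : Fin n) :
    0 ≤ alpha C ε i j :=
  div_nonneg (patternProb_nonneg hε i j _) (patternProb_nonneg hε i j _)

lemma alpha_mul_patternProb_rankOne (hε : ε ∈ Set.Icc (0 : ℝ) 1) (C : LinearCode n)
    (i j : Fin n) :
    alpha C ε i j * patternProb ε i j (rankOne C i j) = patternProb ε i j (B4 C i j) := by
  refine div_mul_cancel_of_imp fun h => le_antisymm ?_ (patternProb_nonneg hε i j _)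
  rw [← h]
  exact patternProb_mono hε i j Set.subset_union_right

end RankOne

section Entropy

variable {Ω α β : Type*} [Fintype Ω]

lemma sum_indicator_lawOf [Fintype β] (p : Ω → ℝ) (V : Ω → β) (S : Set β) :
    ∑ v, S.indicator (lawOf p V) v = ∑ ω, (V ⁻¹' S).indicator p ω := by
  classical
  have hterm (v : β) : S.indicator (lawOf p V) v =
      ∑ ω, if V ω = v then (V ⁻¹' S).indicator p ω else 0 := by
    by_cases hv : v ∈ S
    · rw [Set.indicator_of_mem hv]
      exact Finset.sum_congr rfl fun ω _ => by by_cases hω : V ω = v <;> simp [hω, hv]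
    · rw [Set.indicator_of_notMem hv]
      exact (Finset.sum_eq_zero fun ω _ => by by_cases hω : V ω = v <;> simp [hω, hv]).symm
  simp only [hterm]
  rw [Finset.sum_comm]
  simp

lemma lawOf_eq_of_equiv {p : Ω → ℝ} (e : Ω ≃ Ω) (hp : ∀ ω, p (e ω) = p ω) {f : Ω → α} {g : Ω → β}
    {a : α} {b : β} (h : ∀ ω, f (e ω) = a ↔ g ω = b) : lawOf p f a = lawOf p g b := by
  classical
  rw [lawOf, ← e.sum_comp]
  exact Finset.sum_congr rfl fun ω _ => if_congr (h ω) (hp ω) rfl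

lemma exists_of_lawOf_ne_zero {p : Ω → ℝ} {f : Ω → α} {a : α} (h : lawOf p f a ≠ 0) :
    ∃ ω, f ω = a ∧ p ω ≠ 0 := by
  obtain ⟨ω, -, hω⟩ := Finset.exists_ne_zero_of_sum_ne_zero h
  exact ⟨ω, by simpa only [ne_eq, ite_eq_right_iff, Classical.not_imp] using hω⟩

lemma lawOf_eq_add_of_bit (p : Ω → ℝ) (U : Ω → ZMod 2) (V : Ω → β) (v : β) :
    lawOf p V v =
      lawOf p (fun ω => (U ω, V ω)) (0, v) + lawOf p (fun ω => (U ω, V ω)) (1, v) := by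
  simp only [lawOf, ← Finset.sum_add_distrib, Prod.mk.injEq]
  refine Finset.sum_congr rfl fun ω _ => ?_
  by_cases hV : V ω = v <;> rcases zmod_two_eq_zero_or_one (U ω) with hU | hU <;> simp [hU, hV]

lemma neg_sum_mul_logb_of_eq (a : ℝ) :
    -(a * Real.logb 2 (a / (a + a)) + a * Real.logb 2 (a / (a + a))) = a + a := by
  rcases eq_or_ne a 0 with rfl | ha
  · simp
  · have h : a / (a + a) = 2⁻¹ := by
      field_simp
      norm_num
    rw [h, Real.logb_inv, Real.logb_self_eq_one one_lt_two]
    ring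

lemma neg_sum_mul_logb_of_eq_zero {a b : ℝ} (h : a = 0 ∨ b = 0) :
    -(a * Real.logb 2 (a / (a + b)) + b * Real.logb 2 (b / (a + b))) = 0 := by
  rcases h with rfl | rfl
  · rcases eq_or_ne b 0 with rfl | h <;> simp [*]
  · rcases eq_or_ne a 0 with rfl | h <;> simp [*]

lemma condEntropy_of_unbiased_or_deterministic [Fintype β] {p : Ω → ℝ} {U : Ω → ZMod 2}
    {V : Ω → β} {S : Set β}
    (hS : ∀ v ∈ S, lawOf p (fun ω => (U ω, V ω)) (0, v) = lawOf p (fun ω => (U ω, V ω)) (1, v))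
    (hS' : ∀ v ∉ S, lawOf p (fun ω => (U ω, V ω)) (0, v) = 0 ∨
      lawOf p (fun ω => (U ω, V ω)) (1, v) = 0) :
    condEntropy p U V = ∑ ω, (V ⁻¹' S).indicator p ω := by
  classical
  rw [← sum_indicator_lawOf, condEntropy, zmod_two_sum, ← Finset.sum_add_distrib,
    ← Finset.sum_neg_distrib]
  refine Finset.sum_congr rfl fun v _ => ?_
  rw [Set.indicator_apply, lawOf_eq_add_of_bit p U V v]
  split_ifs with hv
  · rw [hS v hv]
    exact neg_sum_mul_logb_of_eq _
  · exact neg_sum_mul_logb_of_eq_zero (hS' v hv)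

end Entropy

section Channel

variable {n : ℕ} {C : LinearCode n} {i : Fin n}

/-- The erasure indicator of a channel output. -/
def erasureBit : Option (ZMod 2) → ZMod 2
  | none => 1
  | some _ => 0

lemma erasureBit_eq_one_iff {y : Option (ZMod 2)} : erasureBit y = 1 ↔ y = none := by
  cases y <;> simp [erasureBit]

lemma sum_becKernel_of_erasureBit_eq (ε : ℝ) (x b : ZMod 2) :
    ∑ y, (if erasureBit y = b then becKernel ε x y else 0) = bernoulliWeight ε b := by
  rw [Fintype.sum_option]
  rcases zmod_two_eq_zero_or_one b with rfl | rfl <;> simp [becKernel, erasureBit]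

lemma sum_prod_becKernel_of_erasureBit_eq (ε : ℝ) (x z : Word n) :
    ∑ y : Output n, (if erasureBit ∘ y = z then ∏ k, becKernel ε (x k) (y k) else 0) =
      productWeight (fun _ => ε) z := by
  have hterm (y : Output n) :
      (if erasureBit ∘ y = z then ∏ k, becKernel ε (x k) (y k) else 0) =
        ∏ k, if erasureBit (y k) = z k then becKernel ε (x k) (y k) else 0 := by
    rw [Fintype.prod_ite_zero]
    congr! 1
    exact funext_iff
  simp only [hterm, productWeight,
    ← Fintype.prod_sum fun k y => if erasureBit y = z k then becKernel ε (x k) y else 0,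
    sum_becKernel_of_erasureBit_eq]

open Classical in
lemma sum_uniform_codeword (C : LinearCode n) :
    ∑ x : Word n, (if x ∈ C then (Nat.card C : ℝ)⁻¹ else 0) = 1 := by
  have hcard : ((Finset.univ.filter fun x => x ∈ C).card : ℝ) = Nat.card C := by
    rw [Nat.card_eq_fintype_card, Fintype.card_subtype]
  rw [← Finset.sum_filter, Finset.sum_const, nsmul_eq_mul, hcard,
    mul_inv_cancel₀ (by exact_mod_cast Nat.card_pos.ne')]

lemma lawOf_erasureBit_comp_output (C : LinearCode n) (ε : ℝ) :
    lawOf (jointPMF C ε) (fun ω => erasureBit ∘ ω.2) = productWeight fun _ => ε := by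
  classical
  funext z
  calc lawOf (jointPMF C ε) (fun ω => erasureBit ∘ ω.2) z
      = ∑ x, (if x ∈ C then (Nat.card C : ℝ)⁻¹ else 0) * ∑ y : Output n,
          if erasureBit ∘ y = z then ∏ k, becKernel ε (x k) (y k) else 0 := by
        simp only [lawOf, jointPMF, Fintype.sum_prod_type, Finset.mul_sum, mul_ite, mul_zero]
    _ = productWeight (fun _ => ε) z := by
        simp only [sum_prod_becKernel_of_erasureBit_eq, ← Finset.sum_mul, sum_uniform_codeword,
          one_mul]

/-- Adding the word `c` to the input and to the unerased outputs. -/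
def shiftEquiv (c : Word n) : Word n × Output n ≃ Word n × Output n :=
  (Equiv.addRight c).prodCongr (Equiv.piCongrRight fun k => (Equiv.addRight (c k)).optionCongr)

lemma shiftEquiv_apply (c : Word n) (ω : Word n × Output n) :
    shiftEquiv c ω = (ω.1 + c, fun k => (ω.2 k).map (· + c k)) := rfl

lemma becKernel_add (ε : ℝ) (x c : ZMod 2) (y : Option (ZMod 2)) :
    becKernel ε (x + c) (y.map (· + c)) = becKernel ε x y := by
  cases y <;> simp [becKernel]

lemma jointPMF_shiftEquiv (ε : ℝ) {c : Word n} (hc : c ∈ C) (ω : Word n × Output n) :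
    jointPMF C ε (shiftEquiv c ω) = jointPMF C ε ω := by
  simp only [jointPMF, shiftEquiv_apply, Pi.add_apply, becKernel_add]
  classical
  congr 1
  exact if_congr (C.add_mem_iff_left hc) rfl rfl

lemma mem_of_jointPMF_ne_zero {ε : ℝ} {ω : Word n × Output n} (h : jointPMF C ε ω ≠ 0) :
    ω.1 ∈ C := by
  by_contra hC
  simp [jointPMF, hC] at h

lemma eq_of_jointPMF_ne_zero {ε : ℝ} {ω : Word n × Output n} (h : jointPMF C ε ω ≠ 0) {k : Fin n}
    {b : ZMod 2} (hk : ω.2 k = some b) : ω.1 k = b := by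
  by_contra hb
  refine right_ne_zero_of_mul h (Finset.prod_eq_zero (Finset.mem_univ k) ?_)
  simp [becKernel, hk, Ne.symm hb]

/-- The outputs at the positions other than `i` that do not change when some codeword with
`c i = 1` is added to the input. -/
def ambiguousOutputs (C : LinearCode n) (i : Fin n) :
    Set ({k : Fin n // k ≠ i} → Option (ZMod 2)) :=
  {v | ∃ c ∈ C, c i = 1 ∧ ∀ k : {k : Fin n // k ≠ i}, c k = 1 → v k = none}

lemma restrict_mem_ambiguousOutputs_iff {y : Output n} :
    (fun k : {k : Fin n // k ≠ i} => y k) ∈ ambiguousOutputs C i ↔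
      erasureBit ∘ y ∈ undetermined C i := by
  refine exists_congr fun c => and_congr_right fun _ => and_congr_right fun _ => ?_
  rw [Subtype.forall]
  refine forall_congr' fun k => ?_
  rcases eq_or_ne k i with rfl | hk <;> simp [*, erasureBit_eq_one_iff]

lemma lawOf_bit_eq_of_mem_ambiguousOutputs (ε : ℝ) {v : {k : Fin n // k ≠ i} → Option (ZMod 2)}
    (hv : v ∈ ambiguousOutputs C i) :
    lawOf (jointPMF C ε) (fun ω => (ω.1 i, fun k : {k : Fin n // k ≠ i} => ω.2 k)) (0, v) =
      lawOf (jointPMF C ε) (fun ω => (ω.1 i, fun k : {k : Fin n // k ≠ i} => ω.2 k)) (1, v) := by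
  obtain ⟨c, hc, hi, hv⟩ := hv
  refine lawOf_eq_of_equiv (shiftEquiv c) (jointPMF_shiftEquiv ε hc) fun ω => ?_
  simp only [shiftEquiv_apply, Prod.mk.injEq, funext_iff, Pi.add_apply, hi]
  refine and_congr ?_ (forall_congr' fun k => ?_)
  · rcases zmod_two_eq_zero_or_one (ω.1 i) with h | h <;> simp [h, CharTwo.add_self_eq_zero]
  · rcases zmod_two_eq_zero_or_one (c k) with hk | hk
    · simp [hk]
    · simp [hv k hk]

lemma lawOf_bit_eq_zero_of_notMem_ambiguousOutputs (ε : ℝ)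
    {v : {k : Fin n // k ≠ i} → Option (ZMod 2)} (hv : v ∉ ambiguousOutputs C i) :
    lawOf (jointPMF C ε) (fun ω => (ω.1 i, fun k : {k : Fin n // k ≠ i} => ω.2 k)) (0, v) = 0 ∨
      lawOf (jointPMF C ε) (fun ω => (ω.1 i, fun k : {k : Fin n // k ≠ i} => ω.2 k)) (1, v) =
        0 := by
  by_contra! h
  obtain ⟨ω, hω, hp⟩ := exists_of_lawOf_ne_zero h.1
  obtain ⟨ω', hω', hp'⟩ := exists_of_lawOf_ne_zero h.2
  obtain ⟨hi, hout⟩ := Prod.mk.inj hω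
  obtain ⟨hi', hout'⟩ := Prod.mk.inj hω'
  refine hv ⟨ω.1 + ω'.1, C.add_mem (mem_of_jointPMF_ne_zero hp) (mem_of_jointPMF_ne_zero hp'),
    by simp [hi, hi'], fun k hk => ?_⟩
  by_contra hne
  obtain ⟨b, hb⟩ := Option.ne_none_iff_exists'.1 hne
  have hb₁ := eq_of_jointPMF_ne_zero hp ((congrFun hout k).trans hb)
  have hb₂ := eq_of_jointPMF_ne_zero hp' ((congrFun hout' k).trans hb)
  rw [Pi.add_apply, hb₁, hb₂, CharTwo.add_self_eq_zero] at hk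
  exact zero_ne_one hk

lemma bitEntropy_eq (C : LinearCode n) (ε : ℝ) (i : Fin n) :
    bitEntropy C ε i = productProb (fun _ => ε) (undetermined C i) := by
  have hpreimage : (fun ω : Word n × Output n => fun k : {k : Fin n // k ≠ i} => ω.2 k) ⁻¹'
      ambiguousOutputs C i = (fun ω => erasureBit ∘ ω.2) ⁻¹' undetermined C i :=
    Set.ext fun _ => restrict_mem_ambiguousOutputs_iff
  rw [bitEntropy, condEntropy_of_unbiased_or_deterministic
    (fun v hv => lawOf_bit_eq_of_mem_ambiguousOutputs ε hv)
    (fun v hv => lawOf_bit_eq_zero_of_notMem_ambiguousOutputs ε hv), hpreimage,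
    ← sum_indicator_lawOf, lawOf_erasureBit_comp_output, productProb]

end Channel

section ExitFunction

variable {n : ℕ} {C : LinearCode n} {ε : ℝ}

lemma hasDerivAt_exitFunction (C : LinearCode n) (ε : ℝ) :
    HasDerivAt (exitFunction C)
      (1 / (n : ℝ) * ∑ i, ∑ j ∈ Finset.univ.erase i, patternProb ε i j (B4 C i j)) ε := by
  have h : exitFunction C =
      fun ε => 1 / (n : ℝ) * ∑ i, productProb (fun _ => ε) (undetermined C i) := by
    funext x
    simp only [exitFunction, bitEntropy_eq]
  rw [h]
  exact (HasDerivAt.fun_sum fun i _ => hasDerivAt_productProb_undetermined C i ε).const_mul _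

lemma bitEntropy_eq_exitFunction (hC : OneTransitive C) (ε : ℝ) (i : Fin n) :
    bitEntropy C ε i = exitFunction C ε := by
  have hn : (n : ℝ) ≠ 0 := by exact_mod_cast i.pos.ne'
  simp only [exitFunction, bitEntropy_eq, fun j => productProb_undetermined_eq hC ε j i]
  simp [hn]

lemma bitEntropy_variance_mul_alpha_le_patternProb_B4 (hε : ε ∈ Set.Icc (0 : ℝ) 1)
    (C : LinearCode n) {i j : Fin n} (hij : i ≠ j) :
    bitEntropy C ε i * (1 - bitEntropy C ε i) / (8 * √n) * alpha C ε i j ≤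
      patternProb ε i j (B4 C i j) := by
  rw [bitEntropy_eq, ← alpha_mul_patternProb_rankOne hε, mul_comm]
  exact mul_le_mul_of_nonneg_left (variance_undetermined_div_sqrt_le_rankOne hε hij)
    (alpha_nonneg hε C i j)

end ExitFunction

end ExitBEC

end

theorem theorem5_general {n : ℕ} (C : ExitBEC.LinearCode n) {δ ε : ℝ}
    (hε : ε ∈ Set.Icc (0 : ℝ) 1)
    (hδ : ∀ i, ExitBEC.bitEntropy C ε i ∈ Set.Icc δ (1 - δ)) :
    DifferentiableWithinAt ℝ (ExitBEC.exitFunction C) (Set.Icc (0 : ℝ) 1) ε ∧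
      δ * (1 - δ) / 8 / (n : ℝ) ^ (3 / 2 : ℝ) *
          ∑ i : Fin n, ∑ j ∈ Finset.univ.erase i, ExitBEC.alpha C ε i j ≤
        derivWithin (ExitBEC.exitFunction C) (Set.Icc (0 : ℝ) 1) ε := by
  have hder := (ExitBEC.hasDerivAt_exitFunction C ε).hasDerivWithinAt (s := Set.Icc 0 1)
  refine ⟨hder.differentiableWithinAt, ?_⟩
  have hpow : (n : ℝ) ^ (3 / 2 : ℝ) = n * √n := by
    rw [Real.sqrt_eq_rpow, ← Real.rpow_one_add' (by positivity) (by norm_num)]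
    norm_num
  have hvar (i : Fin n) : δ * (1 - δ) ≤
      ExitBEC.bitEntropy C ε i * (1 - ExitBEC.bitEntropy C ε i) := by
    linarith [mul_nonneg (sub_nonneg.2 (hδ i).1) (sub_nonneg.2 (hδ i).2)]
  calc δ * (1 - δ) / 8 / (n : ℝ) ^ (3 / 2 : ℝ) *
          ∑ i : Fin n, ∑ j ∈ Finset.univ.erase i, ExitBEC.alpha C ε i j
      = 1 / (n : ℝ) * ∑ i : Fin n, ∑ j ∈ Finset.univ.erase i,
          δ * (1 - δ) / (8 * √n) * ExitBEC.alpha C ε i j := by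
        simp only [hpow, ← Finset.mul_sum]
        ring
    _ ≤ 1 / (n : ℝ) * ∑ i : Fin n, ∑ j ∈ Finset.univ.erase i,
          ExitBEC.patternProb ε i j (ExitBEC.B4 C i j) := by
        gcongr with i _ j hj
        refine le_trans ?_ (ExitBEC.bitEntropy_variance_mul_alpha_le_patternProb_B4 hε C
          (Finset.ne_of_mem_erase hj).symm)
        gcongr ?_ / _ * _
        exacts [ExitBEC.alpha_nonneg hε C i j, hvar i]
    _ = derivWithin (ExitBEC.exitFunction C) (Set.Icc (0 : ℝ) 1) ε :=
        (hder.derivWithin (uniqueDiffOn_Icc zero_lt_one ε hε)).symm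

theorem theorem5 :
    ∃ c : ℝ → ℝ,
      (∀ δ₀ : ℝ, 0 < δ₀ → ∃ c₀ : ℝ, 0 < c₀ ∧ ∀ δ : ℝ, δ₀ ≤ δ → δ ≤ 1 / 2 → c₀ ≤ c δ) ∧
      ∀ δ : ℝ, 0 < δ → δ ≤ 1 / 2 →
        ∀ (n : ℕ) (C : ExitBEC.LinearCode n), ExitBEC.OneTransitive C →
          ∀ ε : ℝ, ε ∈ Set.Icc (0 : ℝ) 1 →
            ExitBEC.exitFunction C ε ∈ Set.Ioo δ (1 - δ) →
              DifferentiableWithinAt ℝ (ExitBEC.exitFunction C) (Set.Icc (0 : ℝ) 1) ε ∧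
              c δ / (n : ℝ) ^ (3 / 2 : ℝ) *
                  ∑ i : Fin n, ∑ j ∈ Finset.univ.erase i, ExitBEC.alpha C ε i j ≤
                derivWithin (ExitBEC.exitFunction C) (Set.Icc (0 : ℝ) 1) ε := by
  refine ⟨fun δ => δ * (1 - δ) / 8,
    fun δ₀ h₀ => ⟨δ₀ / 16, by positivity, fun δ _ _ => by nlinarith⟩,
    fun δ _ _ n C hC ε hε hg => theorem5_general C hε fun i => ?_⟩
  rw [ExitBEC.bitEntropy_eq_exitFunction hC]
  exact Set.Ioo_subset_Icc_self hg
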